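/- There is an absolute constant $c > 0$ such that the following holds for every natural number $N$. Let $L$ be a set of $N^2$ distinct lines in $\mathbb{R}^3$ and let $P$ be a set of points in $\mathbb{R}^3$. Suppose that no plane contains more than $N$ lines of $L$, and that each line of $L$ contains at least $N$ points of $P$. Then $|P| \ge c N^3$. -/

import Mathlib

open scoped NNReal ENNReal

/-- Three-dimensional Euclidean space. -/
abbrev Space3 : Type := EuclideanSpace ℝ (Fin 3)

/-- An affine line: an affine subspace of dimension one.
(The empty affine subspace has direction of dimension zero, so it is excluded.) -/
def IsLine (l : AffineSubspace ℝ Space3) : Prop :=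
  Module.finrank ℝ l.direction = 1

/-- An affine plane: an affine subspace of dimension two. -/
def IsPlane (π : AffineSubspace ℝ Space3) : Prop :=
  Module.finrank ℝ π.direction = 2

open MvPolynomial in
/-- Restriction of a polynomial to the parametrized line `t ↦ a + t • v`. -/
noncomputable def restrictLine (a v : Fin 3 → ℝ) :
    MvPolynomial (Fin 3) ℝ →ₐ[ℝ] Polynomial ℝ :=
  aeval fun k => Polynomial.C (a k) + Polynomial.C (v k) * Polynomial.X

section Restriction

open MvPolynomial

lemma restrictLine_X (a v : Fin 3 → ℝ) (k : Fin 3) :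
    restrictLine a v (X k) = Polynomial.C (a k) + Polynomial.C (v k) * Polynomial.X := by
  simp [restrictLine]

lemma restrictLine_C (a v : Fin 3 → ℝ) (r : ℝ) :
    restrictLine a v (C r) = Polynomial.C r := by
  simp [restrictLine]

lemma eval_restrictLine (a v : Fin 3 → ℝ) (p : MvPolynomial (Fin 3) ℝ) (t : ℝ) :
    (restrictLine a v p).eval t = eval (a + t • v) p := by
  induction p using MvPolynomial.induction_on with
  | C r => simp
  | add p q hp hq => simp [hp, hq]
  | mul_X p i hp => simp [hp, restrictLine_X]; left; ring

lemma natDegree_restrictLine_le (a v : Fin 3 → ℝ) (p : MvPolynomial (Fin 3) ℝ) :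
    (restrictLine a v p).natDegree ≤ p.totalDegree := by
  have := MvPolynomial.aeval_natDegree_le (m := p.totalDegree) (n := 1) p le_rfl
    (fun k => Polynomial.C (a k) + Polynomial.C (v k) * Polynomial.X)
    (fun k => by compute_degree)
  simpa [restrictLine] using this

lemma derivative_restrictLine (a v : Fin 3 → ℝ) (p : MvPolynomial (Fin 3) ℝ) :
    Polynomial.derivative (restrictLine a v p) =
      ∑ k, Polynomial.C (v k) * restrictLine a v (pderiv k p) := by
  induction p using MvPolynomial.induction_on with
  | C r => simp
  | add p q hp hq => simp [hp, hq, mul_add, Finset.sum_add_distrib]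
  | mul_X p i hp =>
    simp only [map_mul, Polynomial.derivative_mul, hp, pderiv_mul, map_add, mul_add,
      Finset.sum_add_distrib, Finset.sum_mul]
    congr 1
    · exact Finset.sum_congr rfl fun k _ => by ring
    · rw [Finset.sum_eq_single i]
      · simp [restrictLine_X]; ring
      · intro b _ hb
        rw [pderiv_X_of_ne hb.symm]; simp
      · simp

/-- A polynomial having more zeros on a line than its degree vanishes on the line. -/
lemma restrictLine_eq_zero_of_card (a v : Fin 3 → ℝ) (p : MvPolynomial (Fin 3) ℝ)
    (T : Finset ℝ) (hT : ∀ t ∈ T, eval (a + t • v) p = 0) (hd : p.totalDegree < T.card) :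
    restrictLine a v p = 0 := by
  refine Polynomial.eq_zero_of_natDegree_lt_card_of_eval_eq_zero' _ T ?_
    ((natDegree_restrictLine_le a v p).trans_lt hd)
  intro t ht
  rw [eval_restrictLine, hT t ht]

lemma totalDegree_pderiv_le (k : Fin 3) (p : MvPolynomial (Fin 3) ℝ) :
    (pderiv k p).totalDegree ≤ p.totalDegree := by
  refine Finset.sup_le fun m hm => ?_
  rw [mem_support_iff, coeff_pderiv] at hm
  have h1 : m + Finsupp.single k 1 ∈ p.support := by
    rw [mem_support_iff]; exact fun h => hm (by simp [h])
  have := le_totalDegree h1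
  refine le_trans ?_ this
  rw [Finsupp.sum_add_index' (fun _ => rfl) (fun _ _ _ => rfl)]
  exact Nat.le_add_right _ _

/-- A nonconstant polynomial does not divide all its partial derivatives. -/
lemma exists_not_dvd_pderiv {p : MvPolynomial (Fin 3) ℝ} (hp : p.totalDegree ≠ 0) :
    ∃ k, ¬ p ∣ pderiv k p := by
  have hp0 : p ≠ 0 := by rintro rfl; simp at hp
  obtain ⟨k, hk⟩ : ∃ k, degreeOf k p ≠ 0 := by
    by_contra! h
    refine hp (Nat.le_zero.1 ?_)
    refine Finset.sup_le fun m hm => ?_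
    rw [Finsupp.sum, Nat.le_zero, Finset.sum_eq_zero_iff]
    intro i _
    have := monomial_le_degreeOf i hm
    rw [h i] at this
    omega
  refine ⟨k, fun ⟨r, hr⟩ => ?_⟩
  obtain ⟨m, hm, hmk⟩ : ∃ m ∈ p.support, m k = degreeOf k p := by
    rw [degreeOf_eq_sup]
    obtain ⟨m, hm, h⟩ := Finset.exists_mem_eq_sup p.support (by simpa using hp0) (fun m => m k)
    exact ⟨m, hm, h.symm⟩
  have hne : pderiv k p ≠ 0 := by
    intro h0
    have h1 : coeff (m - Finsupp.single k 1) (pderiv k p) = 0 := by rw [h0]; simp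
    rw [coeff_pderiv, tsub_add_cancel_of_le
      (by rw [Finsupp.single_le_iff]; omega)] at h1
    rw [mem_support_iff] at hm
    rcases mul_eq_zero.1 h1 with h | h
    · exact hm h
    · exact absurd h (by positivity)
  have hr0 : r ≠ 0 := by rintro rfl; simp at hr; exact hne hr
  have h2 : degreeOf k p ≤ degreeOf k (pderiv k p) := by
    rw [hr, degreeOf_mul_eq hp0 hr0]; omega
  have h3 : degreeOf k (pderiv k p) < degreeOf k p := by
    rw [degreeOf_lt_iff (by omega)]
    intro n hn
    rw [mem_support_iff, coeff_pderiv] at hn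
    have h1 : n + Finsupp.single k 1 ∈ p.support := by
      rw [mem_support_iff]; exact fun h => hn (by simp [h])
    have := monomial_le_degreeOf k h1
    simp at this
    omega
  omega

end Restriction

section Box

open MvPolynomial

/-- Polynomials in three variables whose degree in the `i`-th variable is at most `m i`. -/
noncomputable def degreeBox (m : Fin 3 → ℕ) : Submodule ℝ (MvPolynomial (Fin 3) ℝ) :=
  restrictSupport ℝ {n | ∀ i, n i ≤ m i}

lemma mem_degreeBox {m : Fin 3 → ℕ} {p : MvPolynomial (Fin 3) ℝ} :
    p ∈ degreeBox m ↔ ∀ i, degreeOf i p ≤ m i := by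
  simp only [degreeBox, mem_restrictSupport_iff, degreeOf_le_iff]
  exact ⟨fun h i n hn => h hn i, fun h n hn i => h i n hn⟩

/-- Exponent vectors in a box. -/
noncomputable def exponentBoxEquiv (m : Fin 3 → ℕ) :
    {n : Fin 3 →₀ ℕ | ∀ i, n i ≤ m i} ≃ ((i : Fin 3) → Fin (m i + 1)) where
  toFun n i := ⟨n.1 i, Nat.lt_succ_of_le (n.2 i)⟩
  invFun f := ⟨Finsupp.equivFunOnFinite.symm fun i => (f i : ℕ),
    fun i => Nat.le_of_lt_succ (f i).2⟩
  left_inv n := by ext; simp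
  right_inv f := by ext; simp

instance (m : Fin 3 → ℕ) : Finite {n : Fin 3 →₀ ℕ | ∀ i, n i ≤ m i} :=
  Finite.of_equiv _ (exponentBoxEquiv m).symm

instance (m : Fin 3 → ℕ) : Module.Finite ℝ (degreeBox m) :=
  Module.Finite.of_basis (basisRestrictSupport ℝ {n : Fin 3 →₀ ℕ | ∀ i, n i ≤ m i})

lemma finrank_degreeBox (m : Fin 3 → ℕ) :
    Module.finrank ℝ (degreeBox m) = ∏ i, (m i + 1) := by
  rw [degreeBox, Module.finrank_eq_nat_card_basis
    (basisRestrictSupport ℝ {n : Fin 3 →₀ ℕ | ∀ i, n i ≤ m i}),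
    Nat.card_congr (exponentBoxEquiv m)]
  simp

/-- A finite set of points lies in the zero set of a polynomial of controlled degree. -/
lemma exists_vanishing_on_finset (P : Finset (Fin 3 → ℝ)) (D : ℕ) (h : P.card < (D + 1) ^ 3) :
    ∃ p : MvPolynomial (Fin 3) ℝ, p ≠ 0 ∧ p.totalDegree ≤ 3 * D ∧ ∀ x ∈ P, eval x p = 0 := by
  let φ : degreeBox (fun _ => D) →ₗ[ℝ] (P → ℝ) :=
    { toFun := fun p x => eval x.1 p.1
      map_add' := fun p q => by ext; simp
      map_smul' := fun r p => by ext; simp }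
  have hker : LinearMap.ker φ ≠ ⊥ := by
    apply LinearMap.ker_ne_bot_of_finrank_lt
    rw [finrank_degreeBox]
    simpa using h
  obtain ⟨p, hp, hp0⟩ := Submodule.exists_mem_ne_zero_of_ne_bot hker
  refine ⟨p.1, by simpa using hp0, ?_, fun x hx => congrFun (LinearMap.mem_ker.1 hp) ⟨x, hx⟩⟩
  refine Finset.sup_le fun n hn => ?_
  rw [Finsupp.sum_fintype _ _ (fun _ => rfl)]
  have := p.2
  rw [mem_degreeBox] at this
  calc ∑ i, n i ≤ ∑ _i : Fin 3, D :=
        Finset.sum_le_sum fun i _ => (monomial_le_degreeOf i hn).trans (this i)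
    _ = 3 * D := by simp

/-- The affine form `x ↦ c ⬝ (x - a)`. -/
noncomputable def affineForm (c a : Fin 3 → ℝ) : MvPolynomial (Fin 3) ℝ :=
  ∑ k, C (c k) * (X k - C (a k))

lemma totalDegree_affineForm_le (c a : Fin 3 → ℝ) : (affineForm c a).totalDegree ≤ 1 := by
  refine (totalDegree_finsetSum _ _).trans (Finset.sup_le fun k _ => ?_)
  refine (totalDegree_mul _ _).trans ?_
  rw [totalDegree_C, zero_add]
  refine (totalDegree_sub_C_le _ _).trans ?_
  simp

lemma eval_affineForm (c a x : Fin 3 → ℝ) : eval x (affineForm c a) = c ⬝ᵥ (x - a) := by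
  simp [affineForm, dotProduct]

lemma restrictLine_affineForm (c a b v : Fin 3 → ℝ) :
    restrictLine b v (affineForm c a) =
      Polynomial.C (c ⬝ᵥ (b - a)) + Polynomial.C (c ⬝ᵥ v) * Polynomial.X := by
  simp only [affineForm, dotProduct, map_sum, map_mul, map_sub, restrictLine_X, restrictLine_C,
    Finset.sum_mul, ← Finset.sum_add_distrib, Pi.sub_apply]
  exact Finset.sum_congr rfl fun k _ => by ring

/-- An affine form vanishing on a line but not at a given point off the line. -/
lemma exists_affineForm_separating {a v x : Fin 3 → ℝ} (hv : v ≠ 0)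
    (hx : ∀ r : ℝ, x ≠ a + r • v) :
    ∃ c, restrictLine a v (affineForm c a) = 0 ∧ eval x (affineForm c a) ≠ 0 := by
  have hvv : v ⬝ᵥ v ≠ 0 := fun h => hv (dotProduct_self_eq_zero.1 h)
  set r := ((x - a) ⬝ᵥ v) / (v ⬝ᵥ v) with hr
  set c := (x - a) - r • v with hc
  have hcv : c ⬝ᵥ v = 0 := by
    rw [hc, sub_dotProduct, smul_dotProduct, hr, smul_eq_mul, div_mul_cancel₀ _ hvv, sub_self]
  refine ⟨c, by simp [restrictLine_affineForm, hcv], ?_⟩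
  rw [eval_affineForm, show x - a = c + r • v by rw [hc]; abel, dotProduct_add, dotProduct_smul,
    hcv, smul_zero, add_zero]
  intro h
  have h0 := dotProduct_self_eq_zero.1 h
  refine hx r ?_
  rw [h0, eq_comm, sub_eq_zero] at hc
  rw [← hc]; abel

lemma bezout_arithmetic {M s : ℕ} {a b : Fin 3 → ℕ} {A B : ℕ} (ha : ∀ i, a i ≤ A)
    (hb : ∀ i, b i ≤ B) (hs : s = M * M + M + A + B)
    (h : ∏ i, (s - a i + 1) + (∏ i, (s - b i + 1) + M * (s + 1 - M)) ≤
      (s + 1) ^ 3 + ∏ i, (s - a i - b i + 1)) : M ≤ 6 * A * B := by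
  have h1 : ∀ i, ((s - a i + 1 : ℕ) : ℤ) = s + 1 - a i := fun i => by have := ha i; omega
  have h2 : ∀ i, ((s - b i + 1 : ℕ) : ℤ) = s + 1 - b i := fun i => by have := hb i; omega
  have h3 : ∀ i, ((s - a i - b i + 1 : ℕ) : ℤ) = s + 1 - a i - b i := fun i => by
    have := ha i; have := hb i; omega
  have h4 : ((s + 1 - M : ℕ) : ℤ) = s + 1 - M := by
    have : M ≤ s + 1 := by nlinarith
    omega
  have hZ : (∏ i, ((s - a i + 1 : ℕ) : ℤ)) + ((∏ i, ((s - b i + 1 : ℕ) : ℤ)) +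
      M * ((s + 1 - M : ℕ) : ℤ)) ≤ (s + 1) ^ 3 + ∏ i, ((s - a i - b i + 1 : ℕ) : ℤ) := by
    exact_mod_cast h
  simp only [h1, h2, h3, h4, Fin.prod_univ_three] at hZ
  have hE : (a 0 * b 1 + a 1 * b 0 + a 0 * b 2 + a 2 * b 0 + a 1 * b 2 + a 2 * b 1 : ℤ) ≤
      6 * A * B := by
    have key : ∀ i j, a i * b j ≤ A * B := fun i j => Nat.mul_le_mul (ha i) (hb j)
    have := key 0 1; have := key 1 0; have := key 0 2
    have := key 2 0; have := key 1 2; have := key 2 1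
    norm_cast
    linarith
  have hpos : (0 : ℤ) ≤ a 0 * a 1 * b 2 + a 0 * b 1 * a 2 + b 0 * a 1 * a 2 +
      b 0 * b 1 * a 2 + b 0 * a 1 * b 2 + a 0 * b 1 * b 2 := by positivity
  have hkey : (M : ℤ) * (s + 1 - M) ≤ (6 * A * B) * (s + 1) := by
    refine le_trans ?_ (mul_le_mul_of_nonneg_right hE (by positivity))
    linarith
  by_contra! hlt
  have h5 : (6 * A * B + 1 : ℤ) ≤ M := by exact_mod_cast hlt
  have h6 : (s : ℤ) = M * M + M + A + B := by exact_mod_cast hs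
  have h7 : (6 * A * B : ℤ) * (s + 1) ≤ (M - 1) * (s + 1) :=
    mul_le_mul_of_nonneg_right (by linarith) (by positivity)
  nlinarith

/-- Two relatively prime polynomials have few common lines. -/
theorem card_lines_le_of_isRelPrime {ι : Type*} [Fintype ι] {p q : MvPolynomial (Fin 3) ℝ}
    (hpq : IsRelPrime p q) (hq : q ≠ 0) (a v : ι → Fin 3 → ℝ)
    (hv : ∀ i, v i ≠ 0)
    (hdist : ∀ i j, i ≠ j → ∃ t : ℝ, ∀ r : ℝ, a i + t • v i ≠ a j + r • v j)
    (hpl : ∀ i, restrictLine (a i) (v i) p = 0) (hql : ∀ i, restrictLine (a i) (v i) q = 0) :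
    Fintype.card ι ≤ 6 * p.totalDegree * q.totalDegree := by
  classical
  set M := Fintype.card ι with hM
  set s := M * M + M + p.totalDegree + q.totalDegree with hs
  refine bezout_arithmetic (a := fun i => degreeOf i p) (b := fun i => degreeOf i q)
    (fun i => degreeOf_le_totalDegree p i) (fun i => degreeOf_le_totalDegree q i) hs ?_
  -- affine forms separating the lines
  have hsep : ∀ i j, ∃ l : MvPolynomial (Fin 3) ℝ, l.totalDegree ≤ 1 ∧
      (i ≠ j → restrictLine (a j) (v j) l = 0 ∧ restrictLine (a i) (v i) l ≠ 0) := by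
    intro i j
    by_cases hij : i = j
    · exact ⟨0, by simp, fun h => absurd hij h⟩
    · obtain ⟨t, ht⟩ := hdist i j hij
      obtain ⟨c, hc, hc'⟩ := exists_affineForm_separating (hv j) ht
      refine ⟨_, totalDegree_affineForm_le c (a j), fun _ => ⟨hc, fun h0 => hc' ?_⟩⟩
      rw [← eval_restrictLine, h0, Polynomial.eval_zero]
  choose l hl1 hl using hsep
  let h : ι → MvPolynomial (Fin 3) ℝ := fun i => ∏ j ∈ Finset.univ.erase i, l i j
  have hh0 : ∀ i j, i ≠ j → restrictLine (a j) (v j) (h i) = 0 := fun i j hij => by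
    rw [map_prod]
    exact Finset.prod_eq_zero (Finset.mem_erase.2 ⟨hij.symm, Finset.mem_univ j⟩) (hl i j hij).1
  have hh1 : ∀ i, restrictLine (a i) (v i) (h i) ≠ 0 := fun i => by
    rw [map_prod]
    exact Finset.prod_ne_zero_iff.2 fun j hj => (hl i j (Finset.ne_of_mem_erase hj).symm).2
  have hhd : ∀ i, (h i).totalDegree ≤ M := fun i => by
    refine (totalDegree_finsetProd _ _).trans ((Finset.sum_le_sum fun j _ => hl1 i j).trans ?_)
    simp [hM]
  -- affine coordinates along the lines
  have hvv : ∀ i, v i ⬝ᵥ v i ≠ 0 := fun i h0 => hv i (dotProduct_self_eq_zero.1 h0)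
  let lam : ι → MvPolynomial (Fin 3) ℝ := fun i => affineForm ((v i ⬝ᵥ v i)⁻¹ • v i) (a i)
  have hlam : ∀ i, restrictLine (a i) (v i) (lam i) = Polynomial.X := fun i => by
    simp [lam, restrictLine_affineForm, hvv i]
  let Ψ : (degreeBox (fun i => s - degreeOf i p) × degreeBox (fun i => s - degreeOf i q) ×
      (ι → Polynomial.degreeLT ℝ (s + 1 - M))) →ₗ[ℝ] MvPolynomial (Fin 3) ℝ :=
    { toFun := fun x => p * x.1.1 + q * x.2.1.1 +
        ∑ i, h i * Polynomial.aeval (lam i) (x.2.2 i).1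
      map_add' := fun x y => by
        simp [mul_add, Finset.sum_add_distrib]; ring
      map_smul' := fun r x => by
        simp [smul_add, Finset.smul_sum] }
  have hΨ : ∀ x, Ψ x = p * x.1.1 + q * x.2.1.1 +
        ∑ i, h i * Polynomial.aeval (lam i) (x.2.2 i).1 := fun x => rfl
  have hrange : LinearMap.range Ψ ≤ degreeBox (fun _ => s) := by
    rintro _ ⟨x, rfl⟩
    rw [hΨ]
    refine add_mem (add_mem ?_ ?_) (sum_mem fun i _ => ?_)
    · rw [mem_degreeBox]
      intro i
      have h1 := mem_degreeBox.1 x.1.2 i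
      have h2 := degreeOf_le_totalDegree p i
      have h3 := degreeOf_mul_le i p x.1.1
      omega
    · rw [mem_degreeBox]
      intro i
      have h1 := mem_degreeBox.1 x.2.1.2 i
      have h2 := degreeOf_le_totalDegree q i
      have h3 := degreeOf_mul_le i q x.2.1.1
      omega
    · rw [mem_degreeBox]
      intro j
      refine (degreeOf_le_totalDegree _ _).trans ((totalDegree_mul _ _).trans ?_)
      have h2 : (Polynomial.aeval (lam i) (x.2.2 i).1).totalDegree ≤ s - M := by
        rw [Polynomial.aeval_eq_sum_range]
        refine (totalDegree_finsetSum _ _).trans (Finset.sup_le fun k hk => ?_)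
        refine (totalDegree_smul_le _ _).trans ((totalDegree_pow _ _).trans ?_)
        have h4 := (x.2.2 i).2
        have h5 : k ≤ s - M := by
          by_cases h0 : (x.2.2 i).1 = 0
          · rw [h0] at hk; simp at hk; omega
          rw [Polynomial.mem_degreeLT, Polynomial.degree_eq_natDegree h0, Nat.cast_lt] at h4
          rw [Finset.mem_range] at hk
          omega
        calc k * (lam i).totalDegree ≤ k * 1 :=
              Nat.mul_le_mul_left _ (totalDegree_affineForm_le _ _)
          _ ≤ s - M := by omega
      have := hhd i
      omega
  have hker : ∀ x, Ψ x = 0 → x.2.2 = 0 ∧ p * x.1.1 = q * -x.2.1.1 := by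
    intro x hx
    have h1 : x.2.2 = 0 := by
      ext1 i
      have h2 := congrArg (restrictLine (a i) (v i)) hx
      rw [hΨ, map_add, map_add, map_mul, map_mul, hpl, hql, map_sum,
        Finset.sum_eq_single i (fun j _ hj => by rw [map_mul, hh0 j i hj, zero_mul])
          (fun h => absurd (Finset.mem_univ i) h), map_mul,
        ← Polynomial.aeval_algHom_apply, hlam] at h2
      simp [hh1 i] at h2
      simpa using h2
    refine ⟨h1, ?_⟩
    rw [hΨ, h1] at hx
    simp at hx
    linear_combination hx
  let φ : LinearMap.ker Ψ →ₗ[ℝ] MvPolynomial (Fin 3) ℝ :=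
    (Submodule.subtype _ ∘ₗ LinearMap.fst ℝ _ _) ∘ₗ Submodule.subtype (LinearMap.ker Ψ)
  have hφ : ∀ x, φ x = x.1.1.1 := fun x => rfl
  have hφinj : Function.Injective φ := by
    intro x y hxy
    obtain ⟨hx1, hx2⟩ := hker x.1 x.2
    obtain ⟨hy1, hy2⟩ := hker y.1 y.2
    rw [hφ, hφ] at hxy
    rw [hxy, hy2] at hx2
    have h3 := neg_injective (mul_left_cancel₀ hq hx2)
    exact Subtype.ext (Prod.ext (Subtype.ext hxy)
      (Prod.ext (Subtype.ext h3.symm) (hx1.trans hy1.symm)))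
  have hφrange : LinearMap.range φ ≤
      (degreeBox (fun i => s - degreeOf i p - degreeOf i q)).map (LinearMap.mulLeft ℝ q) := by
    rintro _ ⟨x, rfl⟩
    obtain ⟨h1, h2⟩ := hker x.1 x.2
    obtain ⟨r, hr⟩ : q ∣ x.1.1.1 := hpq.symm.dvd_of_dvd_mul_left ⟨_, h2⟩
    refine ⟨r, mem_degreeBox.2 fun i => ?_, by simp [hφ, hr]⟩
    by_cases hr0 : r = 0
    · simp [hr0]
    have h3 := mem_degreeBox.1 x.1.1.2 i
    rw [hr, degreeOf_mul_eq hq hr0] at h3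
    omega
  have e1 := LinearMap.finrank_range_add_finrank_ker Ψ
  have e2 := Submodule.finrank_mono hrange
  have e3 := LinearMap.finrank_range_of_inj hφinj
  have e4 := Submodule.finrank_mono hφrange
  have e5 := Submodule.finrank_map_le (LinearMap.mulLeft ℝ q)
    (degreeBox (fun i => s - degreeOf i p - degreeOf i q))
  have e6 : Module.finrank ℝ (Polynomial.degreeLT ℝ (s + 1 - M)) = s + 1 - M := by
    rw [LinearEquiv.finrank_eq (Polynomial.degreeLTEquiv ℝ (s + 1 - M))]; simp
  rw [Module.finrank_prod, Module.finrank_prod, Module.finrank_pi_fintype] at e1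
  simp only [finrank_degreeBox, e6, Finset.sum_const, Finset.card_univ, smul_eq_mul, ← hM] at e1 e2 e5
  rw [Finset.prod_const, Finset.card_univ, Fintype.card_fin] at e2
  omega

end Box

section FlatAlgebra

open Matrix

variable {R S : Type*} [CommRing R] [CommRing S]

/-- The coefficients of the quadratic form `H` restricted to the orthogonal complement of `g`,
which is spanned by the cross products of `g` with the coordinate vectors. -/
def tangentCoeff (g : Fin 3 → R) (H : Fin 3 → Fin 3 → R) (j k : Fin 3) : R :=
  ∑ a, ∑ b, H a b * (g ⨯₃ Pi.single j 1) a * (g ⨯₃ Pi.single k 1) b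

lemma map_tangentCoeff (φ : R →+* S) (g : Fin 3 → R) (H : Fin 3 → Fin 3 → R) (j k : Fin 3) :
    φ (tangentCoeff g H j k) = tangentCoeff (fun i => φ (g i)) (fun a b => φ (H a b)) j k := by
  fin_cases j <;> fin_cases k <;> simp [tangentCoeff, cross_apply, Fin.sum_univ_three]

lemma tangentCoeff_smul_add (q : R) (g r : Fin 3 → R) (H : Fin 3 → Fin 3 → R) (j k : Fin 3) :
    tangentCoeff (fun i => q * g i) (fun a b => q * H a b + g a * r b + g b * r a) j k =
      q ^ 3 * tangentCoeff g H j k := by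
  fin_cases j <;> fin_cases k <;> simp [tangentCoeff, cross_apply, Fin.sum_univ_three] <;> ring

lemma exists_quadratic_eq_tangentCoeff (g w : Fin 3 → R) (H : Fin 3 → Fin 3 → R) :
    ∃ A, (g ⬝ᵥ g) ^ 2 * ∑ a, ∑ b, H a b * w a * w b =
      (g ⬝ᵥ w) * A + ∑ j, ∑ k, (g ⨯₃ w) j * (g ⨯₃ w) k * tangentCoeff g H j k := by
  refine ⟨∑ a, ∑ b, H a b *
    (g a * (g ⬝ᵥ g) * w b + w a * (g ⬝ᵥ g) * g b - (g ⬝ᵥ w) * g a * g b), ?_⟩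
  simp [tangentCoeff, cross_apply, Fin.sum_univ_three, dotProduct]
  ring

/-- A quadratic form vanishing on three pairwise independent vectors of a plane vanishes
on the plane. -/
lemma tangentCoeff_eq_zero {g v₁ v₂ v₃ : Fin 3 → ℝ} {H : Fin 3 → Fin 3 → ℝ}
    (hsymm : ∀ a b, H a b = H b a) (h12 : v₁ ⨯₃ v₂ ≠ 0) (h23 : v₃ ⨯₃ v₂ ≠ 0)
    (h13 : v₁ ⨯₃ v₃ ≠ 0)
    (g1 : g ⬝ᵥ v₁ = 0) (g2 : g ⬝ᵥ v₂ = 0) (g3 : g ⬝ᵥ v₃ = 0)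
    (H1 : ∑ a, ∑ b, H a b * v₁ a * v₁ b = 0) (H2 : ∑ a, ∑ b, H a b * v₂ a * v₂ b = 0)
    (H3 : ∑ a, ∑ b, H a b * v₃ a * v₃ b = 0) (j k : Fin 3) :
    tangentCoeff g H j k = 0 := by
  by_cases hg : g = 0
  · subst hg; simp [tangentCoeff]
  have hgg : g ⬝ᵥ g ≠ 0 := fun h => hg (dotProduct_self_eq_zero.1 h)
  -- every cross product of two tangent vectors is a multiple of `g`
  have hpar : ∀ u v : Fin 3 → ℝ, g ⬝ᵥ u = 0 → g ⬝ᵥ v = 0 → u ⨯₃ v ≠ 0 →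
      ∃ r : ℝ, r ≠ 0 ∧ u ⨯₃ v = r • g := by
    intro u v hu hv huv
    have : u ⨯₃ v = (((u ⨯₃ v) ⬝ᵥ g) / (g ⬝ᵥ g)) • g := by
      ext i
      rw [Pi.smul_apply, smul_eq_mul, div_mul_eq_mul_div, eq_div_iff hgg]
      simp only [dotProduct, Fin.sum_univ_three] at hu hv ⊢
      fin_cases i <;> simp [cross_apply]
      · linear_combination -(g 1 * u 2 - g 2 * u 1) * hv + (g 1 * v 2 - g 2 * v 1) * hu
      · linear_combination -(g 2 * u 0 - g 0 * u 2) * hv + (g 2 * v 0 - g 0 * v 2) * hu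
      · linear_combination -(g 0 * u 1 - g 1 * u 0) * hv + (g 0 * v 1 - g 1 * v 0) * hu
    refine ⟨_, fun h0 => huv ?_, this⟩
    rw [this, h0, zero_smul]
  obtain ⟨r, hr, hr'⟩ := hpar v₁ v₂ g1 g2 h12
  obtain ⟨α, hα, hα'⟩ := hpar v₃ v₂ g3 g2 h23
  obtain ⟨β, hβ, hβ'⟩ := hpar v₁ v₃ g1 g3 h13
  have hv₃ : ∀ i, r * v₃ i = α * v₁ i + β * v₂ i := by
    intro i
    have e : (v₁ ⨯₃ v₂) ⬝ᵥ g * v₃ i = (v₃ ⨯₃ v₂) ⬝ᵥ g * v₁ i + (v₁ ⨯₃ v₃) ⬝ᵥ g * v₂ i := by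
      simp only [dotProduct, Fin.sum_univ_three] at g1 g2 g3 ⊢
      fin_cases i <;> simp [cross_apply]
      · linear_combination (v₂ 1 * v₃ 2 - v₂ 2 * v₃ 1) * g1 + (v₃ 1 * v₁ 2 - v₃ 2 * v₁ 1) * g2 +
          (v₁ 1 * v₂ 2 - v₁ 2 * v₂ 1) * g3
      · linear_combination (v₂ 2 * v₃ 0 - v₂ 0 * v₃ 2) * g1 + (v₃ 2 * v₁ 0 - v₃ 0 * v₁ 2) * g2 +
          (v₁ 2 * v₂ 0 - v₁ 0 * v₂ 2) * g3
      · linear_combination (v₂ 0 * v₃ 1 - v₂ 1 * v₃ 0) * g1 + (v₃ 0 * v₁ 1 - v₃ 1 * v₁ 0) * g2 +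
          (v₁ 0 * v₂ 1 - v₁ 1 * v₂ 0) * g3
    rw [hr', hα', hβ'] at e
    simp only [smul_dotProduct, smul_eq_mul] at e
    apply mul_left_cancel₀ hgg
    linear_combination e
  set B : (Fin 3 → ℝ) → (Fin 3 → ℝ) → ℝ := fun u v => ∑ a, ∑ b, H a b * u a * v b with hB
  have hlin : ∀ (x y z t : ℝ) (u v : Fin 3 → ℝ),
      B (x • u + y • v) (z • u + t • v) = x * z * B u u + (x * t) * B u v +
        (y * z) * B v u + y * t * B v v := by
    intro x y z t u v
    simp [hB, Fin.sum_univ_three]; ring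
  have hBs : B v₂ v₁ = B v₁ v₂ := by
    simp only [hB]
    rw [Finset.sum_comm]
    exact Finset.sum_congr rfl fun a _ => Finset.sum_congr rfl fun b _ => by
      rw [hsymm b a]; ring
  have h12' : B v₁ v₂ = 0 := by
    have e1 : B (r • v₃ + (0 : ℝ) • v₃) (r • v₃ + (0 : ℝ) • v₃) =
        B (α • v₁ + β • v₂) (α • v₁ + β • v₂) := by
      have : r • v₃ = α • v₁ + β • v₂ := funext hv₃
      simp [this]
    rw [hlin, hlin, hBs, show B v₁ v₁ = 0 from H1, show B v₂ v₂ = 0 from H2,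
      show B v₃ v₃ = 0 from H3] at e1
    have : α * β * B v₁ v₂ = 0 := by linarith
    exact (mul_eq_zero.1 this).resolve_left (mul_ne_zero hα hβ)
  have hcross : ∀ j, r • (g ⨯₃ Pi.single j 1) = v₁ j • v₂ + (-v₂ j) • v₁ := by
    intro j
    rw [← LinearMap.smul_apply, ← map_smul, ← hr']
    ext i
    fin_cases j <;> fin_cases i <;> simp [cross_apply] <;> ring
  have hfin : r ^ 2 * tangentCoeff g H j k = B (r • (g ⨯₃ Pi.single j 1))
      (r • (g ⨯₃ Pi.single k 1)) := by
    simp only [tangentCoeff, hB, Finset.mul_sum, Pi.smul_apply, smul_eq_mul]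
    exact Finset.sum_congr rfl fun a _ => Finset.sum_congr rfl fun b _ => by ring
  rw [hcross, hcross, hlin, hBs, h12', show B v₁ v₁ = 0 from H1, show B v₂ v₂ = 0 from H2] at hfin
  have : r ^ 2 * tangentCoeff g H j k = 0 := by linarith
  exact (mul_eq_zero.1 this).resolve_left (pow_ne_zero 2 hr)

end FlatAlgebra

section ODE

open Polynomial

/-- Uniqueness for a linear second order differential equation, for polynomials. -/
lemma eq_zero_of_linear_ode {f A B G : ℝ[X]}
    (h : G * derivative (derivative f) = derivative f * A + f * B) (hG : G.eval 0 ≠ 0)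
    (h0 : f.eval 0 = 0) (h1 : (derivative f).eval 0 = 0) : f = 0 := by
  by_contra hf
  obtain ⟨m, e, he, rfl⟩ : ∃ m, ∃ e : ℝ[X], e.eval 0 ≠ 0 ∧ f = X ^ m * e := by
    obtain ⟨e, he, hne⟩ := exists_eq_pow_rootMultiplicity_mul_and_not_dvd f hf 0
    simp only [map_zero, sub_zero] at he hne
    exact ⟨_, e, fun h => hne (by rwa [X_dvd_iff, coeff_zero_eq_eval_zero]), he⟩
  rcases m with _ | _ | n
  · simp at h0; exact he h0
  · simp at h1; exact he h1
  · have hX : (X : ℝ[X]) ^ n ≠ 0 := pow_ne_zero _ X_ne_zero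
    have h2 : G * (((n : ℝ[X]) + 2) * ((n : ℝ[X]) + 1) * e + X * (2 * ((n : ℝ[X]) + 2) * derivative e +
        X * derivative (derivative e))) =
        X * ((((n : ℝ[X]) + 2) * e + X * derivative e) * A + X * e * B) := by
      apply mul_left_cancel₀ hX
      simp only [derivative_mul, derivative_X_pow, Nat.add_sub_cancel, map_natCast,
        Nat.cast_add, Nat.cast_one, derivative_natCast, derivative_one, map_add, map_one] at h
      linear_combination h
    have h3 := congrArg (eval 0) h2
    simp at h3
    rcases h3 with h3 | (h3 | h3) | h3
    · exact hG h3
    · exact absurd h3 (by positivity)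
    · exact absurd h3 (by positivity)
    · exact he h3

end ODE

section Flat

open MvPolynomial Matrix

/-- The coefficients of the second fundamental form of the surface `p = 0`, up to scaling. -/
noncomputable def flatPoly (p : MvPolynomial (Fin 3) ℝ) (j k : Fin 3) : MvPolynomial (Fin 3) ℝ :=
  tangentCoeff (fun i => pderiv i p) (fun a b => pderiv a (pderiv b p)) j k

lemma totalDegree_flatPoly_le (p : MvPolynomial (Fin 3) ℝ) (j k : Fin 3) :
    (flatPoly p j k).totalDegree ≤ 3 * p.totalDegree := by
  have hg : ∀ j a, (((fun i => pderiv i p) ⨯₃ Pi.single j 1 : Fin 3 → _) a).totalDegree ≤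
      p.totalDegree := by
    intro j a
    fin_cases j <;> fin_cases a <;> simp [cross_apply, totalDegree_pderiv_le]
  refine (totalDegree_finsetSum _ _).trans (Finset.sup_le fun a _ => ?_)
  refine (totalDegree_finsetSum _ _).trans (Finset.sup_le fun b _ => ?_)
  have h1 := totalDegree_mul (pderiv a (pderiv b p) *
    ((fun i => pderiv i p) ⨯₃ Pi.single j 1 : Fin 3 → _) a)
    (((fun i => pderiv i p) ⨯₃ Pi.single k 1 : Fin 3 → _) b)
  have h2 := totalDegree_mul (pderiv a (pderiv b p))
    (((fun i => pderiv i p) ⨯₃ Pi.single j 1 : Fin 3 → _) a)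
  have h3 := (totalDegree_pderiv_le a (pderiv b p)).trans (totalDegree_pderiv_le b p)
  have := hg j a
  have := hg k b
  exact h1.trans (by omega)

lemma dvd_flatPoly_of_dvd_flatPoly_mul {p q : MvPolynomial (Fin 3) ℝ} (hpq : IsRelPrime p q)
    {j k : Fin 3} (h : p ∣ flatPoly (p * q) j k) : p ∣ flatPoly p j k := by
  have key : p ∣ flatPoly (p * q) j k - q ^ 3 * flatPoly p j k := by
    rw [← Ideal.mem_span_singleton, ← Ideal.Quotient.eq]
    have hp : Ideal.Quotient.mk (Ideal.span {p}) p = 0 :=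
      Ideal.Quotient.eq_zero_iff_mem.2 (Ideal.mem_span_singleton_self p)
    rw [map_mul, map_pow, flatPoly, flatPoly, map_tangentCoeff, map_tangentCoeff,
      ← tangentCoeff_smul_add _ _ (fun i => Ideal.Quotient.mk (Ideal.span {p}) (pderiv i q))]
    congr 1
    · funext i
      rw [pderiv_mul]; simp [hp, mul_comm]
    · funext a b
      simp only [pderiv_mul, map_add, map_mul, hp]
      ring
  exact (hpq.pow_right).dvd_of_dvd_mul_left ((dvd_sub_right h).1 key)

lemma pderiv_pderiv_comm' (p : MvPolynomial (Fin 3) ℝ) (a b : Fin 3) :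
    pderiv a (pderiv b p) = pderiv b (pderiv a p) := by
  ext m
  simp only [coeff_pderiv]
  rw [add_right_comm]
  by_cases h : a = b
  · subst h; rfl
  · simp [h, Ne.symm h]; ring

lemma sum_pderiv_eq_zero {a v : Fin 3 → ℝ} {p : MvPolynomial (Fin 3) ℝ}
    (h : restrictLine a v p = 0) (t : ℝ) :
    (fun i => eval (a + t • v) (pderiv i p)) ⬝ᵥ v = 0 := by
  have h1 := congrArg (Polynomial.eval t) (derivative_restrictLine a v p)
  rw [h] at h1
  simp only [Polynomial.derivative_zero, Polynomial.eval_zero, Polynomial.eval_finsetSum,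
    Polynomial.eval_mul, Polynomial.eval_C, eval_restrictLine] at h1
  rw [dotProduct_comm]
  exact h1.symm

lemma derivative_derivative_restrictLine (a v : Fin 3 → ℝ) (p : MvPolynomial (Fin 3) ℝ) :
    Polynomial.derivative (Polynomial.derivative (restrictLine a v p)) =
      ∑ i, ∑ j, restrictLine a v (pderiv i (pderiv j p)) * Polynomial.C (v i) *
        Polynomial.C (v j) := by
  rw [derivative_restrictLine, map_sum, Finset.sum_comm]
  refine Finset.sum_congr rfl fun j _ => ?_
  rw [Polynomial.derivative_C_mul, derivative_restrictLine, Finset.mul_sum]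
  exact Finset.sum_congr rfl fun i _ => by ring

lemma sum_pderiv_pderiv_eq_zero {a v : Fin 3 → ℝ} {p : MvPolynomial (Fin 3) ℝ}
    (h : restrictLine a v p = 0) (t : ℝ) :
    ∑ i, ∑ j, eval (a + t • v) (pderiv i (pderiv j p)) * v i * v j = 0 := by
  have h1 := congrArg (Polynomial.eval t) (derivative_derivative_restrictLine a v p)
  rw [h] at h1
  simp only [Polynomial.derivative_zero, Polynomial.eval_zero, Polynomial.eval_finsetSum,
    Polynomial.eval_mul, Polynomial.eval_C, eval_restrictLine] at h1
  exact h1.symm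

/-- A surface is flat at every point lying on three of its lines. -/
lemma eval_flatPoly_eq_zero {p : MvPolynomial (Fin 3) ℝ} {x : Fin 3 → ℝ}
    (a v : Fin 3 → Fin 3 → ℝ) (hp : ∀ i, restrictLine (a i) (v i) p = 0)
    (hx : ∀ i, ∃ t : ℝ, x = a i + t • v i)
    (hv : ∀ i j, i ≠ j → v i ⨯₃ v j ≠ 0) (j k : Fin 3) : eval x (flatPoly p j k) = 0 := by
  rw [flatPoly, map_tangentCoeff]
  have h1 : ∀ i, (fun k => eval x (pderiv k p)) ⬝ᵥ v i = 0 := fun i => by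
    obtain ⟨t, rfl⟩ := hx i
    exact sum_pderiv_eq_zero (hp i) t
  have h2 : ∀ i, ∑ k, ∑ l, eval x (pderiv k (pderiv l p)) * v i k * v i l = 0 := fun i => by
    obtain ⟨t, rfl⟩ := hx i
    exact sum_pderiv_pderiv_eq_zero (hp i) t
  exact tangentCoeff_eq_zero (fun a b => by rw [pderiv_pderiv_comm'])
    (hv 0 1 (by decide)) (hv 2 1 (by decide)) (hv 0 2 (by decide)) (h1 0) (h1 1) (h1 2)
    (h2 0) (h2 1) (h2 2) j k

/-- A flat surface contains its tangent lines. -/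
lemma restrictLine_eq_zero_of_flat {p : MvPolynomial (Fin 3) ℝ}
    (hflat : ∀ j k, p ∣ flatPoly p j k) {x w : Fin 3 → ℝ} (hx : eval x p = 0)
    (hg : (fun i => eval x (pderiv i p)) ≠ 0)
    (hw : (fun i => eval x (pderiv i p)) ⬝ᵥ w = 0) : restrictLine x w p = 0 := by
  choose r hr using hflat
  have hg' : ((fun i => eval x (pderiv i p)) ⬝ᵥ fun i => eval x (pderiv i p)) ≠ 0 :=
    fun h => hg (dotProduct_self_eq_zero.1 h)
  obtain ⟨A, hq⟩ := exists_quadratic_eq_tangentCoeff (fun i => restrictLine x w (pderiv i p))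
    (fun i => Polynomial.C (w i)) (fun a b => restrictLine x w (pderiv a (pderiv b p)))
  rw [← derivative_derivative_restrictLine] at hq
  have hd : ((fun i => restrictLine x w (pderiv i p)) ⬝ᵥ fun i => Polynomial.C (w i)) =
      Polynomial.derivative (restrictLine x w p) := by
    rw [derivative_restrictLine]
    exact Finset.sum_congr rfl fun i _ => by ring
  rw [hd] at hq
  have ht : ∀ j k, tangentCoeff (fun i => restrictLine x w (pderiv i p))
      (fun a b => restrictLine x w (pderiv a (pderiv b p))) j k =
      restrictLine x w p * restrictLine x w (r j k) := by
    intro j k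
    rw [← map_mul, ← hr, flatPoly]
    exact (map_tangentCoeff (restrictLine x w).toRingHom _ _ j k).symm
  simp only [ht] at hq
  refine eq_zero_of_linear_ode (A := A) (B := ∑ j, ∑ k,
    ((fun i => restrictLine x w (pderiv i p)) ⨯₃ fun i => Polynomial.C (w i)) j *
    ((fun i => restrictLine x w (pderiv i p)) ⨯₃ fun i => Polynomial.C (w i)) k *
      restrictLine x w (r j k)) (hq.trans ?_) ?_ ?_ ?_
  · congr 1
    simp only [Finset.mul_sum]
    exact Finset.sum_congr rfl fun j _ => Finset.sum_congr rfl fun k _ => by ring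
  · simpa [dotProduct, Polynomial.eval_finsetSum, eval_restrictLine] using hg'
  · simpa [eval_restrictLine] using hx
  · rw [← hd]
    simpa [dotProduct, Polynomial.eval_finsetSum, eval_restrictLine] using hw

lemma exists_tangent_pair {g : Fin 3 → ℝ} (hg : g ≠ 0) :
    ∃ u v : Fin 3 → ℝ, g ⬝ᵥ u = 0 ∧ g ⬝ᵥ v = 0 ∧ u ⨯₃ v ≠ 0 := by
  obtain ⟨u, hu, hgu⟩ : ∃ u : Fin 3 → ℝ, u ≠ 0 ∧ g ⬝ᵥ u = 0 := by
    by_contra! h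
    have h0 : ∀ j, g ⨯₃ Pi.single j 1 = 0 := fun j => by
      by_contra h1
      exact h _ h1 (dot_self_cross _ _)
    have h1 := h0 0
    have h2 := congrFun (h0 1) 2
    simp only [funext_iff, Fin.forall_fin_succ, cross_apply] at h1
    simp [cross_apply] at h1 h2
    exact hg (funext fun i => by fin_cases i <;> simp [h1, h2])
  refine ⟨u, g ⨯₃ u, hgu, dot_self_cross g u, fun h => ?_⟩
  have h1 : (u ⬝ᵥ u) • g = 0 := by
    rw [← h]
    simp only [dotProduct, Fin.sum_univ_three] at hgu
    ext i
    fin_cases i <;> simp [cross_apply, dotProduct, Fin.sum_univ_three]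
    · linear_combination u 0 * hgu
    · linear_combination u 1 * hgu
    · linear_combination u 2 * hgu
  rcases smul_eq_zero.1 h1 with h2 | h2
  · exact hu (dotProduct_self_eq_zero.1 h2)
  · exact hg h2

/-- An irreducible flat surface with a smooth point is a plane. -/
theorem dvd_affineForm_of_flat {p : MvPolynomial (Fin 3) ℝ} (hirr : Irreducible p)
    (hflat : ∀ j k, p ∣ flatPoly p j k) {x : Fin 3 → ℝ} (hx : eval x p = 0)
    (hg : (fun i => eval x (pderiv i p)) ≠ 0) :
    p ∣ affineForm (fun i => eval x (pderiv i p)) x := by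
  set g := (fun i => eval x (pderiv i p)) with hgdef
  obtain ⟨u, v, hu, hv, huv⟩ := exists_tangent_pair hg
  have hlin : LinearIndependent ℝ ![u, v] := crossProduct_ne_zero_iff_linearIndependent.1 huv
  rw [LinearIndependent.pair_iff] at hlin
  by_contra hdvd
  have hrel : IsRelPrime p (affineForm g x) := (hirr.isRelPrime_iff_not_dvd).2 hdvd
  have hne : affineForm g x ≠ 0 := fun h => hdvd (h ▸ dvd_zero p)
  have hw : ∀ r : ℝ, g ⬝ᵥ (u + r • v) = 0 := fun r => by
    rw [dotProduct_add, dotProduct_smul, hu, hv]; simp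
  have hcard := card_lines_le_of_isRelPrime hrel hne
    (fun _ : Fin (6 * p.totalDegree * (affineForm g x).totalDegree + 1) => x)
    (fun n => u + (n : ℝ) • v) ?_ ?_ ?_ ?_
  · simp at hcard
  · intro n h0
    have := (hlin 1 n (by simpa using h0)).1
    exact one_ne_zero this
  · intro i j hij
    refine ⟨1, fun r h => hij ?_⟩
    have h1 : (1 - r) • u + (i - r * j) • v = 0 := by
      have := add_left_cancel h
      rw [one_smul, smul_add, smul_smul] at this
      rw [sub_smul, sub_smul, one_smul]
      linear_combination (exp := 1) this
    obtain ⟨h2, h3⟩ := hlin _ _ h1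
    have h4 : r = 1 := by linarith
    rw [h4, one_mul, sub_eq_zero] at h3
    exact Fin.ext (by exact_mod_cast h3)
  · exact fun n => restrictLine_eq_zero_of_flat hflat hx hg (hw n)
  · intro n
    rw [restrictLine_affineForm, hw]
    simp

end Flat

section Counting

open MvPolynomial Matrix

lemma restrictLine_eq_zero_of_points {a v : Fin 3 → ℝ} {p : MvPolynomial (Fin 3) ℝ}
    (T : Finset (Fin 3 → ℝ)) (hT : ∀ x ∈ T, ∃ t : ℝ, x = a + t • v)
    (hp : ∀ x ∈ T, eval x p = 0) (hd : p.totalDegree < T.card) : restrictLine a v p = 0 := by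
  classical
  obtain ⟨T', -, rfl⟩ := (Finset.subset_set_image_iff (s := Set.univ) (t := T)
    (f := fun t : ℝ => a + t • v)).1 fun x hx => by
      obtain ⟨t, rfl⟩ := hT x hx
      exact ⟨t, trivial, rfl⟩
  exact restrictLine_eq_zero_of_card a v p T'
    (fun t ht => hp _ (Finset.mem_image_of_mem _ ht)) (hd.trans_le Finset.card_image_le)

lemma totalDegree_ne_zero_of_irreducible {p : MvPolynomial (Fin 3) ℝ} (hp : Irreducible p) :
    p.totalDegree ≠ 0 := by
  intro h
  rw [totalDegree_eq_zero_iff_eq_C] at h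
  refine hp.not_isUnit ?_
  rw [h]
  refine IsUnit.map C (isUnit_iff_ne_zero.2 fun h0 => hp.ne_zero ?_)
  rw [h, h0, C_0]

variable {ι : Type*} {a v : ι → Fin 3 → ℝ}

/-- A polynomial of least degree vanishing on a family of lines is squarefree. -/
lemma exists_squarefree_vanishing {p : MvPolynomial (Fin 3) ℝ} (hp : p ≠ 0)
    (h : ∀ i, restrictLine (a i) (v i) p = 0) :
    ∃ Q : MvPolynomial (Fin 3) ℝ, Q ≠ 0 ∧ Squarefree Q ∧ Q.totalDegree ≤ p.totalDegree ∧
      ∀ i, restrictLine (a i) (v i) Q = 0 := by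
  obtain ⟨Q, ⟨hQ0, hQ⟩, hmin⟩ := (measure totalDegree).wf.has_min
    {q : MvPolynomial (Fin 3) ℝ | q ≠ 0 ∧ ∀ i, restrictLine (a i) (v i) q = 0} ⟨p, hp, h⟩
  have hmin' : ∀ q, q ≠ 0 → (∀ i, restrictLine (a i) (v i) q = 0) →
      Q.totalDegree ≤ q.totalDegree := fun q h1 h2 => not_lt.1 (hmin q ⟨h1, h2⟩)
  refine ⟨Q, hQ0, ?_, hmin' p hp h, hQ⟩
  rintro x ⟨r, rfl⟩
  have hx : x ≠ 0 := by rintro rfl; simp at hQ0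
  have hr : r ≠ 0 := by rintro rfl; simp at hQ0
  have h1 := hmin' (x * r) (mul_ne_zero hx hr) fun i => by
    have := hQ i
    simp only [map_mul, mul_eq_zero, or_self] at this
    rwa [map_mul, mul_eq_zero]
  rw [totalDegree_mul_of_isDomain (mul_ne_zero hx hx) hr, totalDegree_mul_of_isDomain hx hx,
    totalDegree_mul_of_isDomain hx hr] at h1
  have h2 : x.totalDegree = 0 := by omega
  rw [totalDegree_eq_zero_iff_eq_C] at h2
  rw [h2]
  exact IsUnit.map C (isUnit_iff_ne_zero.2 fun h0 => hx (by rw [h2, h0, C_0]))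

lemma card_filter_lines_le (hv : ∀ i, v i ≠ 0)
    (hdist : ∀ i j, i ≠ j → ∃ t : ℝ, ∀ r : ℝ, a i + t • v i ≠ a j + r • v j)
    (T : Finset ι) {p q : MvPolynomial (Fin 3) ℝ} (hp : Irreducible p) (hpq : ¬ p ∣ q)
    (hpT : ∀ i ∈ T, restrictLine (a i) (v i) p = 0)
    (hqT : ∀ i ∈ T, restrictLine (a i) (v i) q = 0) :
    T.card ≤ 6 * p.totalDegree * q.totalDegree := by
  rw [← Fintype.card_coe]
  exact card_lines_le_of_isRelPrime (hp.isRelPrime_iff_not_dvd.2 hpq)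
    (fun h => hpq (h ▸ dvd_zero p)) (fun i : T => a i) (fun i => v i) (fun i => hv i)
    (fun i j hij => hdist i j (fun h => hij (Subtype.ext h)))
    (fun i => hpT i i.2) (fun i => hqT i i.2)

/-- Flat lines on an irreducible component of a surface. -/
lemma card_flat_lines_irreducible_le (hv : ∀ i, v i ≠ 0)
    (hdist : ∀ i j, i ≠ j → ∃ t : ℝ, ∀ r : ℝ, a i + t • v i ≠ a j + r • v j)
    {N : ℕ} (T : Finset ι)
    (hplane : ∀ c x : Fin 3 → ℝ, c ≠ 0 →
      (∀ i ∈ T, restrictLine (a i) (v i) (affineForm c x) = 0) → T.card ≤ N)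
    {p q : MvPolynomial (Fin 3) ℝ} (hp : Irreducible p) (hpq : IsRelPrime p q) (hq : q ≠ 0)
    (hpT : ∀ i ∈ T, restrictLine (a i) (v i) p = 0)
    (hflat : ∀ i ∈ T, ∀ j k, restrictLine (a i) (v i) (flatPoly (p * q) j k) = 0) :
    T.card ≤ p.totalDegree * (18 * (p * q).totalDegree + N) := by
  have hdeg : p.totalDegree ≤ (p * q).totalDegree := by
    rw [totalDegree_mul_of_isDomain hp.ne_zero hq]; omega
  have hpos : 1 ≤ p.totalDegree := Nat.pos_of_ne_zero (totalDegree_ne_zero_of_irreducible hp)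
  by_cases hcrit : ∀ x, eval x p = 0 → (fun i => eval x (pderiv i p)) = 0
  · obtain ⟨k, hk⟩ := exists_not_dvd_pderiv (totalDegree_ne_zero_of_irreducible hp)
    have := card_filter_lines_le hv hdist T hp hk hpT fun i hi => by
      refine Polynomial.funext fun t => ?_
      rw [eval_restrictLine, Polynomial.eval_zero]
      refine congrFun (hcrit _ ?_) k
      rw [← eval_restrictLine, hpT i hi, Polynomial.eval_zero]
    have h2 := totalDegree_pderiv_le k p
    calc T.card ≤ 6 * p.totalDegree * (pderiv k p).totalDegree := this
      _ ≤ 6 * p.totalDegree * (p * q).totalDegree := Nat.mul_le_mul_left _ (h2.trans hdeg)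
      _ = p.totalDegree * (6 * (p * q).totalDegree) := by ring
      _ ≤ _ := Nat.mul_le_mul_left _ (by omega)
  · push Not at hcrit
    obtain ⟨x, hx, hg⟩ := hcrit
    by_cases hdvd : ∀ j k, p ∣ flatPoly (p * q) j k
    · obtain ⟨r, hr⟩ := dvd_affineForm_of_flat hp
        (fun j k => dvd_flatPoly_of_dvd_flatPoly_mul hpq (hdvd j k)) hx hg
      have := hplane _ x hg fun i hi => by rw [hr, map_mul, hpT i hi, zero_mul]
      calc T.card ≤ 1 * N := by omega
        _ ≤ _ := Nat.mul_le_mul hpos (by omega)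
    · push Not at hdvd
      obtain ⟨j, k, hjk⟩ := hdvd
      calc T.card ≤ 6 * p.totalDegree * (flatPoly (p * q) j k).totalDegree :=
            card_filter_lines_le hv hdist T hp hjk hpT fun i hi => hflat i hi j k
        _ ≤ 6 * p.totalDegree * (3 * (p * q).totalDegree) :=
            Nat.mul_le_mul_left _ (totalDegree_flatPoly_le _ _ _)
        _ = p.totalDegree * (18 * (p * q).totalDegree) := by ring
        _ ≤ _ := Nat.mul_le_mul_left _ (by omega)

open Classical in
/-- A squarefree surface contains few flat lines, if few of them lie in a common plane. -/
theorem card_flat_lines_le (hv : ∀ i, v i ≠ 0)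
    (hdist : ∀ i j, i ≠ j → ∃ t : ℝ, ∀ r : ℝ, a i + t • v i ≠ a j + r • v j)
    {N : ℕ} (hplane : ∀ c x : Fin 3 → ℝ, c ≠ 0 → ∀ T : Finset ι,
      (∀ i ∈ T, restrictLine (a i) (v i) (affineForm c x) = 0) → T.card ≤ N)
    {Q : MvPolynomial (Fin 3) ℝ} (hQ : Squarefree Q) (hQ0 : Q ≠ 0) (s : Finset ι)
    (hs : ∀ i ∈ s, restrictLine (a i) (v i) Q = 0)
    (hflat : ∀ i ∈ s, ∀ j k, restrictLine (a i) (v i) (flatPoly Q j k) = 0) :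
    s.card ≤ Q.totalDegree * (18 * Q.totalDegree + N) := by
  suffices h : ∀ p, p ∣ Q → (s.filter fun i => restrictLine (a i) (v i) p = 0).card ≤
      p.totalDegree * (18 * Q.totalDegree + N) by
    have := h Q dvd_rfl
    rwa [Finset.filter_true_of_mem hs] at this
  intro p
  induction p using WfDvdMonoid.induction_on_irreducible with
  | zero => exact fun h => absurd (zero_dvd_iff.1 h) hQ0
  | unit u hu =>
    intro _
    rw [Finset.filter_false_of_mem fun i _ => (hu.map (restrictLine (a i) (v i))).ne_zero]
    simp
  | mul b p hb hp ih =>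
    rintro ⟨c, hc⟩
    have hpb : p ≠ 0 := hp.ne_zero
    have hQp : Q = p * (b * c) := by rw [hc, mul_assoc]
    have hrel : IsRelPrime p (b * c) := by
      refine hp.isRelPrime_iff_not_dvd.2 fun ⟨r, hr⟩ => hp.not_isUnit (hQ p ⟨r, ?_⟩)
      rw [hQp, hr, mul_assoc]
    have h1 := card_flat_lines_irreducible_le hv hdist
      (s.filter fun i => restrictLine (a i) (v i) p = 0)
      (fun c x hc h => hplane c x hc _ h) hp hrel
      (fun h0 => hQ0 (by rw [hQp, h0, mul_zero]))
      (fun i hi => (Finset.mem_filter.1 hi).2)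
      (fun i hi => by rw [← hQp]; exact hflat i (Finset.mem_filter.1 hi).1)
    rw [← hQp] at h1
    have h2 := ih ⟨p * c, by rw [hQp]; ring⟩
    calc _ ≤ ((s.filter fun i => restrictLine (a i) (v i) p = 0) ∪
          (s.filter fun i => restrictLine (a i) (v i) b = 0)).card := by
          refine Finset.card_le_card fun i hi => ?_
          rw [Finset.mem_filter, map_mul, mul_eq_zero] at hi
          rw [Finset.mem_union, Finset.mem_filter, Finset.mem_filter]
          tauto
      _ ≤ _ := Finset.card_union_le _ _
      _ ≤ p.totalDegree * (18 * Q.totalDegree + N) +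
          b.totalDegree * (18 * Q.totalDegree + N) := add_le_add h1 h2
      _ = _ := by rw [totalDegree_mul_of_isDomain hpb hb, add_mul]

/-- Directions of distinct concurrent lines are independent. -/
lemma cross_ne_zero_of_concurrent {a b u w x : Fin 3 → ℝ} (hw : w ≠ 0)
    (hdist : ∃ t : ℝ, ∀ r : ℝ, a + t • u ≠ b + r • w)
    (hx : ∃ t : ℝ, x = a + t • u) (hx' : ∃ t : ℝ, x = b + t • w) : u ⨯₃ w ≠ 0 := by
  intro h
  obtain ⟨c, hc⟩ : ∃ c : ℝ, c • w = u := by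
    by_contra! hne
    have := (LinearIndependent.pair_iff' hw).2 hne
    rw [← crossProduct_ne_zero_iff_linearIndependent, ← neg_ne_zero, neg_cross] at this
    exact this h
  obtain ⟨t, ht⟩ := hdist
  obtain ⟨s, hs⟩ := hx
  obtain ⟨s', hs'⟩ := hx'
  refine ht (s' + (t - s) * c) ?_
  have : a = b + s' • w - s • u := by rw [← hs', hs]; abel
  rw [this, ← hc]
  module

variable [Fintype ι]

open Classical in
lemma card_lines_few_rich_points_mul_le (P : Finset (Fin 3 → ℝ)) (N : ℕ)
    (I : ι → (Fin 3 → ℝ) → Prop)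
    (hpts : ∀ i, N ≤ (P.filter fun x => I i x).card) :
    (Finset.univ.filter fun i => 2 * (P.filter fun x =>
      I i x ∧ 3 ≤ (Finset.univ.filter fun j => I j x).card).card < N).card * N ≤
      4 * P.card := by
  set B := Finset.univ.filter fun i => 2 * (P.filter fun x =>
      I i x ∧ 3 ≤ (Finset.univ.filter fun j => I j x).card).card < N with hB
  set P' := P.filter fun x => ¬ 3 ≤ (Finset.univ.filter fun j => I j x).card with hP'
  have h1 : ∀ i ∈ B, N ≤ 2 * (P'.filter fun x => I i x).card := by
    intro i hi
    have h2 := (Finset.mem_filter.1 hi).2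
    have h3 := hpts i
    have h4 := Finset.card_filter_add_card_filter_not (s := P.filter fun x => I i x)
      (fun x => 3 ≤ (Finset.univ.filter fun j => I j x).card)
    rw [Finset.filter_filter, Finset.filter_filter] at h4
    have h5 : P'.filter (fun x => I i x) = P.filter fun x =>
        I i x ∧ ¬ 3 ≤ (Finset.univ.filter fun j => I j x).card := by
      rw [hP', Finset.filter_filter]
      exact Finset.filter_congr fun x _ => and_comm
    rw [h5]
    omega
  have h2 : ∑ i ∈ B, (P'.filter fun x => I i x).card ≤ 2 * P.card := by
    have h3 : ∑ i ∈ B, (P'.filter fun x => I i x).card =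
        ∑ x ∈ P', (B.filter fun i => I i x).card :=
      Finset.sum_card_bipartiteAbove_eq_sum_card_bipartiteBelow I
    rw [h3]
    calc _ ≤ ∑ x ∈ P', 2 := Finset.sum_le_sum fun x hx => by
          have h4 := (Finset.mem_filter.1 hx).2
          have h5 : (B.filter fun i => I i x).card ≤
              (Finset.univ.filter fun j => I j x).card :=
            Finset.card_le_card (Finset.filter_subset_filter _ (Finset.subset_univ _))
          omega
      _ = P'.card * 2 := by simp
      _ ≤ _ := by
          have : P'.card ≤ P.card := Finset.card_filter_le _ _
          omega
  calc B.card * N = ∑ _i ∈ B, N := by simp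
    _ ≤ ∑ i ∈ B, 2 * (P'.filter fun x => I i x).card := Finset.sum_le_sum h1
    _ ≤ _ := by rw [← Finset.mul_sum]; omega

open Classical in
/-- The incidence estimate for parametrized lines. -/
theorem cube_le_card_points (hv : ∀ i, v i ≠ 0)
    (hdist : ∀ i j, i ≠ j → ∃ t : ℝ, ∀ r : ℝ, a i + t • v i ≠ a j + r • v j)
    {N : ℕ} (hN : 0 < N) (hcard : Fintype.card ι = N ^ 2)
    (hplane : ∀ c x : Fin 3 → ℝ, c ≠ 0 → ∀ T : Finset ι,
      (∀ i ∈ T, restrictLine (a i) (v i) (affineForm c x) = 0) → T.card ≤ N)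
    (P : Finset (Fin 3 → ℝ))
    (hpts : ∀ i, N ≤ (P.filter fun x => ∃ t : ℝ, x = a i + t • v i).card) :
    N ^ 3 ≤ 10 ^ 6 * P.card := by
  by_contra! hlt
  set D := N / 100 with hD
  have hD1 : 100 * D ≤ N := Nat.mul_div_le N 100
  have hD2 : N ≤ 100 * (D + 1) := by omega
  have hPD : P.card < (D + 1) ^ 3 := by
    have := Nat.pow_le_pow_left hD2 3
    rw [mul_pow] at this
    omega
  obtain ⟨p, hp0, hpd, hpP⟩ := exists_vanishing_on_finset P D hPD
  obtain ⟨Q, hQ0, hQ, hQd, hQL⟩ := exists_squarefree_vanishing (a := a) (v := v) hp0 fun i =>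
    restrictLine_eq_zero_of_points (P.filter fun x => ∃ t : ℝ, x = a i + t • v i)
      (fun x hx => (Finset.mem_filter.1 hx).2) (fun x hx => hpP x (Finset.mem_filter.1 hx).1)
      (by have := hpts i; omega)
  have hbad := card_lines_few_rich_points_mul_le P N (fun i x => ∃ t : ℝ, x = a i + t • v i) hpts
  set rich : ι → Finset (Fin 3 → ℝ) := fun i => P.filter fun x => (∃ t : ℝ, x = a i + t • v i) ∧
    3 ≤ (Finset.univ.filter fun j => ∃ t : ℝ, x = a j + t • v j).card with hrich
  have hgood := card_flat_lines_le hv hdist hplane hQ hQ0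
    (Finset.univ.filter fun i => ¬ 2 * (rich i).card < N) (fun i _ => hQL i) ?_
  · have hsum := Finset.card_filter_add_card_filter_not (s := (Finset.univ : Finset ι))
      (fun i => 2 * (rich i).card < N)
    rw [Finset.card_univ, hcard] at hsum
    set x := (Finset.univ.filter fun i => 2 * (rich i).card < N).card
    set y := (Finset.univ.filter fun i => ¬ 2 * (rich i).card < N).card
    have hd : 100 * Q.totalDegree ≤ 3 * N := by omega
    have hy : 10000 * y ≤ 462 * N ^ 2 := by
      calc 10000 * y ≤ (100 * Q.totalDegree) * (18 * (100 * Q.totalDegree) + 100 * N) := by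
            linarith
        _ ≤ (3 * N) * (18 * (3 * N) + 100 * N) := by gcongr
        _ = 462 * N ^ 2 := by ring
    have hx : 10 ^ 6 * x ≤ 4 * N ^ 2 := by
      refine Nat.le_of_mul_le_mul_right ?_ hN
      calc 10 ^ 6 * x * N = 10 ^ 6 * (x * N) := by ring
        _ ≤ 10 ^ 6 * (4 * P.card) := Nat.mul_le_mul_left _ hbad
        _ ≤ 4 * N ^ 3 := by omega
        _ = 4 * N ^ 2 * N := by ring
    have : 0 < N ^ 2 := by positivity
    omega
  · intro i hi j k
    have hi' := (Finset.mem_filter.1 hi).2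
    refine restrictLine_eq_zero_of_points (rich i) (fun x hx => (Finset.mem_filter.1 hx).2.1)
      (fun x hx => ?_) ?_
    · obtain ⟨e, he⟩ := Finset.le_card_iff_exists_subset_card.1 (Finset.mem_filter.1 hx).2.2
      obtain ⟨h1, h2⟩ := he
      let f : Fin 3 ≃ e := (Finset.equivFinOfCardEq h2).symm
      have hf : ∀ n, ∃ t : ℝ, x = a (f n) + t • v (f n) := fun n =>
        (Finset.mem_filter.1 (h1 (f n).2)).2
      exact eval_flatPoly_eq_zero (fun n => a (f n)) (fun n => v (f n)) (fun n => hQL _) hf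
        (fun m n hmn => cross_ne_zero_of_concurrent (hv _)
          (hdist _ _ fun h => hmn (f.injective (Subtype.ext h))) (hf m) (hf n)) j k
    · have := totalDegree_flatPoly_le Q j k
      omega

end Counting

section EuclideanLines

open Matrix

lemma IsLine.nonempty {l : AffineSubspace ℝ Space3} (hl : IsLine l) :
    (l : Set Space3).Nonempty := by
  rw [AffineSubspace.nonempty_iff_ne_bot]
  rintro rfl
  rw [IsLine, AffineSubspace.direction_bot, finrank_bot] at hl
  exact zero_ne_one hl

/-- A line in coordinates. -/
lemma IsLine.exists_param {l : AffineSubspace ℝ Space3} (hl : IsLine l) :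
    ∃ a v : Fin 3 → ℝ, v ≠ 0 ∧
      ∀ x : Space3, x ∈ l ↔ ∃ t : ℝ, x.ofLp = a + t • v := by
  have hne := hl.nonempty
  obtain ⟨p, hp⟩ := hne
  obtain ⟨v, hv, hspan⟩ := finrank_eq_one_iff'.1 hl
  refine ⟨p.ofLp, v.1.ofLp, fun h => hv (Subtype.ext (WithLp.ofLp_injective 2 h)), fun x => ?_⟩
  rw [← AffineSubspace.vsub_right_mem_direction_iff_mem hp]
  constructor
  · intro h
    obtain ⟨c, hc⟩ := hspan ⟨x -ᵥ p, h⟩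
    refine ⟨c, ?_⟩
    have h1 : c • v.1 = x - p := congrArg Subtype.val hc
    rw [← WithLp.ofLp_smul, ← WithLp.ofLp_add, h1, add_sub_cancel]
  · rintro ⟨t, ht⟩
    have h1 : x -ᵥ p = t • v.1 := by
      apply WithLp.ofLp_injective 2
      simp [ht]
    rw [h1]
    exact Submodule.smul_mem _ _ v.2

lemma IsLine.eq_of_le {l l' : AffineSubspace ℝ Space3} (hl : IsLine l) (hl' : IsLine l')
    (h : l ≤ l') : l = l' := by
  have hne := hl.nonempty
  refine AffineSubspace.eq_of_direction_eq_of_nonempty_of_le ?_ hne h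
  exact Submodule.eq_of_le_of_finrank_eq (AffineSubspace.direction_le h) (hl.trans hl'.symm)

/-- The zero set of a nonzero affine form is a plane. -/
lemma exists_isPlane_affineForm {c : Fin 3 → ℝ} (hc : c ≠ 0) (x : Fin 3 → ℝ) :
    ∃ π : AffineSubspace ℝ Space3, IsPlane π ∧
      ∀ y : Space3, MvPolynomial.eval y.ofLp (affineForm c x) = 0 → y ∈ π := by
  let φ : Space3 →ₗ[ℝ] ℝ :=
    { toFun := fun y => c ⬝ᵥ y.ofLp
      map_add' := fun y z => by simp [dotProduct_add]
      map_smul' := fun r y => by simp [dotProduct_smul] }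
  have hφ : φ ≠ 0 := fun h => hc <| dotProduct_self_eq_zero.1 <| by
    have := LinearMap.congr_fun h (WithLp.toLp 2 c)
    simpa [φ] using this
  refine ⟨AffineSubspace.mk' (WithLp.toLp 2 x) (LinearMap.ker φ), ?_, fun y hy => ?_⟩
  · have := Module.Dual.finrank_ker_add_one_of_ne_zero hφ
    rw [finrank_euclideanSpace, Fintype.card_fin] at this
    rw [IsPlane, AffineSubspace.direction_mk']
    omega
  · rw [eval_affineForm] at hy
    rw [AffineSubspace.mem_mk', LinearMap.mem_ker]
    simpa [φ] using hy

end EuclideanLines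

theorem theorem2 :
    ∃ c : ℝ≥0, 0 < c ∧
      ∀ (N : ℕ) (L : Set (AffineSubspace ℝ Space3)) (P : Set Space3),
        (∀ l ∈ L, IsLine l) →
        L.encard = (N : ℕ∞) ^ 2 →
        (∀ π : AffineSubspace ℝ Space3, IsPlane π → {l ∈ L | l ≤ π}.encard ≤ (N : ℕ∞)) →
        (∀ l ∈ L, (N : ℕ∞) ≤ (P ∩ (l : Set Space3)).encard) →
        (c : ℝ≥0∞) * (N : ℝ≥0∞) ^ 3 ≤ (P.encard : ℝ≥0∞) := by
  classical
  refine ⟨(10 ^ 6)⁻¹, by positivity, fun N L P hL hcard hplane hpts => ?_⟩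
  rcases Nat.eq_zero_or_pos N with rfl | hN
  · simp
  by_cases hP : P.Finite
  swap
  · rw [Set.not_finite.1 hP |>.encard_eq]; simp
  have hLfin : L.Finite := Set.finite_of_encard_eq_coe (k := N ^ 2) (by rw [hcard]; norm_cast)
  have : Fintype L := hLfin.fintype
  choose a v hv hmem using fun l : L => (hL l l.2).exists_param
  have hLcard : Fintype.card L = N ^ 2 := by
    have h1 : L.encard = (Fintype.card L : ℕ∞) := by
      rw [Set.encard_eq_coe_toFinset_card, Set.toFinset_card]
    rw [h1] at hcard
    exact_mod_cast hcard
  set P' : Finset (Fin 3 → ℝ) := hP.toFinset.image WithLp.ofLp with hP'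
  have hP'card : P'.card = hP.toFinset.card :=
    Finset.card_image_of_injective _ (WithLp.ofLp_injective 2)
  have key : N ^ 3 ≤ 10 ^ 6 * P'.card := by
    refine cube_le_card_points (a := a) hv ?_ hN hLcard ?_ P' ?_
    · intro i j hij
      by_contra! h
      refine hij (Subtype.ext ((hL i i.2).eq_of_le (hL j j.2) fun x hx => ?_))
      obtain ⟨t, ht⟩ := (hmem i x).1 hx
      obtain ⟨r, hr⟩ := h t
      exact (hmem j x).2 ⟨r, ht.trans hr⟩
    · intro c x hc T hT
      obtain ⟨π, hπ, hπ'⟩ := exists_isPlane_affineForm hc x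
      have h1 : ((T.map (Function.Embedding.subtype (· ∈ L)) : Finset _) :
          Set (AffineSubspace ℝ Space3)) ⊆ {l ∈ L | l ≤ π} := by
        intro l hl
        simp only [Finset.coe_map, Set.mem_image, Finset.mem_coe] at hl
        obtain ⟨i, hi, rfl⟩ := hl
        refine ⟨i.2, fun y hy => hπ' y ?_⟩
        obtain ⟨t, ht⟩ := (hmem i y).1 hy
        rw [ht, ← eval_restrictLine, hT i hi, Polynomial.eval_zero]
      have h2 := (Set.encard_le_encard h1).trans (hplane π hπ)
      rw [Set.encard_coe_eq_coe_finsetCard, Finset.card_map] at h2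
      exact_mod_cast h2
    · intro i
      have h1 : P ∩ (i.1 : Set Space3) = ((hP.toFinset.filter fun x => x ∈ i.1 : Finset _) :
          Set Space3) := by
        ext x; simp
      have h2 := hpts i i.2
      rw [h1, Set.encard_coe_eq_coe_finsetCard, Nat.cast_le] at h2
      refine h2.trans ?_
      rw [← Finset.card_image_of_injective _ (WithLp.ofLp_injective 2)]
      refine Finset.card_le_card fun y hy => ?_
      obtain ⟨x, hx, rfl⟩ := Finset.mem_image.1 hy
      rw [Finset.mem_filter] at hx ⊢
      exact ⟨Finset.mem_image_of_mem _ hx.1, (hmem i x).1 hx.2⟩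
  rw [hP'card] at key
  rw [hP.encard_eq_coe_toFinset_card]
  have h1 : ((N : ℝ≥0∞)) ^ 3 ≤ (10 ^ 6 : ℝ≥0∞) * (hP.toFinset.card : ℝ≥0∞) := by
    exact_mod_cast key
  rw [ENNReal.coe_inv (by positivity)]
  push_cast
  rw [mul_comm, ← div_eq_mul_inv]
  refine ENNReal.div_le_of_le_mul ?_
  rw [mul_comm]
  exact h1
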